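/- Let $S$ be a cancellative, countable, abelian semigroup. Let $\beta S$ be the Stone--Čech compactification of the discrete space $S$, equipped with the unique semigroup operation $\Box$ that extends the product of $S$ and makes $(\beta S,\Box)$ a compact right topological semigroup (so that $p\mapsto p\,\Box\,q$ is continuous for each $q\in\beta S$), and let $S^*=\beta S\setminus S$, which is a subsemigroup of $(\beta S,\Box)$. Let $K(S^*)$ denote the minimum ideal of $S^*$, i.e. the smallest non-empty two-sided semigroup ideal of $S^*$ (with $K(S^*)=\emptyset$ if $S^*=\emptyset$). Let $\ell^1(S^*)$ be the Banach space of all functions $f:S^*\to\mathbb C$ with $\|f\|=\sum_{x\in S^*}|f(x)|<\infty$; it is a Banach algebra under the convolution \[ (f\star g)(t)=\sum\{f(r)g(s): r,s\in S^*,\ r\,\Box\, s=t\}\qquad(t\in S^*), \] and let $\mathbb C S^*$ be its subalgebra of finitely supported functions. For a complex algebra $A$, its (Jacobson) radical is the set of those $a \in A$ that belong to every maximal left ideal of $A^{\#}$, where $A^{\#}$ is the algebra obtained from $A$ by adjoining an identity, with $A^{\#}=A$ when $A$ already has an identity. Let $J(S^*)$ be the radical of $\ell^1(S^*)$, and let $J_0(S^*)$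 be the radical of $\mathbb C S^*$. If $f\in J(S^*)$ or $f\in J_0(S^*)$, then \[ \operatorname{supp} f=\{x\in S^*: f(x)\neq 0\}\subset K(S^*). \] -/

import Mathlib

noncomputable section

/-! ## The radical of a complex algebra -/

/-- The (Jacobson) radical of a complex algebra `A`, not assumed to have an identity: the elements
of `A` that lie in every maximal left ideal of the algebra `A ⊕ ℂ` obtained by adjoining an
identity. If `A` already has an identity, this is the intersection of the maximal left ideals of
`A` itself; see `mem_algRadical_iff_of_unital`. -/
def algRadical (A : Type*) [NonUnitalRing A] [Module ℂ A] [IsScalarTower ℂ A A]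
    [SMulCommClass ℂ A A] : Set A :=
  {a | ∀ M : Ideal (Unitization ℂ A), M.IsMaximal → (a : Unitization ℂ A) ∈ M}

theorem mem_maximal_iff {R : Type*} [Ring R] (x : R) :
    (∀ M : Ideal R, M.IsMaximal → x ∈ M) ↔ ∀ y, ∃ z, z * y * x + z = 1 := by
  have h := Ideal.mem_jacobson_iff (I := (⊥ : Ideal R)) (x := x)
  simp only [Ideal.mem_bot, sub_eq_zero] at h
  rw [← h]
  simp [Ideal.jacobson, Submodule.mem_sInf]

theorem mem_algRadical_iff_of_unital (A : Type*) [Ring A] [Algebra ℂ A] (a : A) :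
    a ∈ algRadical A ↔ ∀ M : Ideal A, M.IsMaximal → a ∈ M := by
  change (∀ M : Ideal (Unitization ℂ A), M.IsMaximal → (a : Unitization ℂ A) ∈ M) ↔ _
  rw [mem_maximal_iff, mem_maximal_iff]
  constructor
  · intro h y
    obtain ⟨z, hz⟩ := h (y : Unitization ℂ A)
    have h1 := congrArg (fun w => w.toProd.1) hz
    have h2 := congrArg (fun w => w.toProd.2) hz
    refine ⟨algebraMap ℂ A z.toProd.1 + z.toProd.2, ?_⟩
    simp at h1 h2
    rw [h1, one_smul, add_mul y] at h2
    rw [h1, map_one, add_mul 1, one_mul, add_mul y, add_left_comm, h2, add_zero]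
  · intro h y
    obtain ⟨z, hz⟩ := h (algebraMap ℂ A y.toProd.1 + y.toProd.2)
    refine ⟨1 + ((z - 1 : A) : Unitization ℂ A), ?_⟩
    ext
    · simp [-Unitization.inr_sub]
    · simp [-Unitization.inr_sub, Algebra.smul_def]
      rw [Algebra.commutes _ (z - 1), ← sub_eq_zero.2 hz]
      noncomm_ring

/-! ## The Banach algebra `ℓ¹(T)` of a semigroup `T` -/

/-- The Banach space `ℓ¹(T)`. -/
def EllOne (T : Type*) : Type _ := lp (fun _ : T => ℂ) 1

namespace EllOne

variable {T : Type*}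

instance : NormedAddCommGroup (EllOne T) := inferInstanceAs (NormedAddCommGroup (lp _ 1))

instance : NormedSpace ℂ (EllOne T) := inferInstanceAs (NormedSpace ℂ (lp _ 1))

instance : CompleteSpace (EllOne T) := inferInstanceAs (CompleteSpace (lp _ 1))

instance : FunLike (EllOne T) T ℂ where
  coe f := f.1
  coe_injective _ _ h := Subtype.ext h

theorem ext {f g : EllOne T} (h : ∀ t, f t = g t) : f = g := DFunLike.ext f g h

@[simp] theorem add_apply (f g : EllOne T) (t : T) : (f + g) t = f t + g t := rfl

@[simp] theorem zero_apply (t : T) : (0 : EllOne T) t = 0 := rfl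

@[simp] theorem smul_apply (c : ℂ) (f : EllOne T) (t : T) : (c • f) t = c * f t := rfl

theorem summable_norm (f : EllOne T) : Summable fun t => ‖f t‖ := by
  have := (memℓp_gen_iff (p := 1) (by simp)).1 f.2
  simp only [ENNReal.toReal_one, Real.rpow_one] at this
  exact this

theorem norm_eq (f : EllOne T) : ‖f‖ = ∑' t, ‖f t‖ := by
  have := lp.norm_eq_tsum_rpow (p := 1) (E := fun _ : T => ℂ) (by simp) f
  simp only [ENNReal.toReal_one, Real.rpow_one, div_one] at this
  exact this

/-- The element of `ℓ¹(T)` given by an absolutely summable function. -/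
def mk (f : T → ℂ) (hf : Summable fun t => ‖f t‖) : EllOne T :=
  ⟨f, (memℓp_gen_iff (p := 1) (by simp)).2 (by simpa using hf)⟩

@[simp] theorem mk_apply (f : T → ℂ) (hf : Summable fun t => ‖f t‖) (t : T) : mk f hf t = f t := rfl

theorem summable_triple (f g h : EllOne T) :
    Summable fun p : T × T × T => f p.1 * (g p.2.1 * h p.2.2) := by
  have h1 := g.summable_norm.mul_norm h.summable_norm
  exact (f.summable_norm.mul_norm h1).of_norm

variable [Semigroup T]

theorem summable_fiber_norm (f g : EllOne T) (t : T) :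
    Summable fun p : {p : T × T // p.1 * p.2 = t} => ‖f p.1.1 * g p.1.2‖ :=
  (f.summable_norm.mul_norm g.summable_norm).subtype _

theorem summable_fiber (f g : EllOne T) (t : T) :
    Summable fun p : {p : T × T // p.1 * p.2 = t} => f p.1.1 * g p.1.2 :=
  (summable_fiber_norm f g t).of_norm

theorem hasSum_fiber_norm (f g : EllOne T) :
    HasSum (fun t => ∑' p : {p : T × T // p.1 * p.2 = t}, ‖f p.1.1 * g p.1.2‖) (‖f‖ * ‖g‖) := by
  have h : HasSum (fun p : T × T => ‖f p.1 * g p.2‖) (‖f‖ * ‖g‖) := by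
    have hs := f.summable_norm.mul_norm g.summable_norm
    have h2 := tsum_mul_tsum_of_summable_norm (f := fun t => ‖f t‖) (g := fun t => ‖g t‖)
      (by simpa using f.summable_norm) (by simpa using g.summable_norm)
    rw [norm_eq, norm_eq, h2]
    simpa [norm_mul] using hs.hasSum
  have h' := (Equiv.sigmaFiberEquiv (fun p : T × T => p.1 * p.2)).hasSum_iff.2 h
  exact h'.sigma fun t => (summable_fiber_norm f g t).hasSum

theorem norm_conv_le (f g : EllOne T) (t : T) :
    ‖∑' p : {p : T × T // p.1 * p.2 = t}, f p.1.1 * g p.1.2‖ ≤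
      ∑' p : {p : T × T // p.1 * p.2 = t}, ‖f p.1.1 * g p.1.2‖ :=
  norm_tsum_le_tsum_norm (summable_fiber_norm f g t)

/-- Convolution: `(f ⋆ g)(t) = ∑ {f(r) g(s) : r s = t}`. -/
instance : Mul (EllOne T) where
  mul f g := mk (fun t => ∑' p : {p : T × T // p.1 * p.2 = t}, f p.1.1 * g p.1.2)
    (.of_nonneg_of_le (fun _ => norm_nonneg _) (norm_conv_le f g) (hasSum_fiber_norm f g).summable)

theorem mul_apply (f g : EllOne T) (t : T) :
    (f * g) t = ∑' p : {p : T × T // p.1 * p.2 = t}, f p.1.1 * g p.1.2 := rfl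

theorem norm_mul_le' (f g : EllOne T) : ‖f * g‖ ≤ ‖f‖ * ‖g‖ := by
  rw [norm_eq (f * g), ← (hasSum_fiber_norm f g).tsum_eq]
  exact Summable.tsum_le_tsum (norm_conv_le f g) (summable_norm _)
    (hasSum_fiber_norm f g).summable

theorem mul_assoc_left (f g h : EllOne T) (t : T) :
    (f * (g * h)) t =
      ∑' p : {p : T × T × T // p.1 * (p.2.1 * p.2.2) = t}, f p.1.1 * (g p.1.2.1 * h p.1.2.2) := by
  let e : (Σ x : {x : T × T // x.1 * x.2 = t}, {y : T × T // y.1 * y.2 = x.1.2}) ≃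
      {p : T × T × T // p.1 * (p.2.1 * p.2.2) = t} :=
    { toFun := fun x => ⟨(x.1.1.1, x.2.1.1, x.2.1.2), by
        obtain ⟨⟨⟨a, b⟩, h⟩, ⟨⟨c, d⟩, h'⟩⟩ := x; simp only at h h' ⊢; rw [h', h]⟩
      invFun := fun p => ⟨⟨(p.1.1, p.1.2.1 * p.1.2.2), p.2⟩, ⟨(p.1.2.1, p.1.2.2), rfl⟩⟩
      left_inv := by
        rintro ⟨⟨⟨a, b⟩, h⟩, ⟨⟨c, d⟩, h'⟩⟩
        simp only at h h'
        subst h'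
        rfl
      right_inv := fun p => rfl }
  have hs : Summable fun p : {p : T × T × T // p.1 * (p.2.1 * p.2.2) = t} =>
      f p.1.1 * (g p.1.2.1 * h p.1.2.2) := (summable_triple f g h).subtype _
  rw [← e.tsum_eq, mul_apply]
  refine Eq.trans (tsum_congr fun x => ?_) (Summable.tsum_sigma (e.summable_iff.2 hs)).symm
  rw [mul_apply, ← tsum_mul_left]
  rfl

theorem mul_assoc_right (f g h : EllOne T) (t : T) :
    ((f * g) * h) t =
      ∑' p : {p : T × T × T // p.1 * (p.2.1 * p.2.2) = t}, f p.1.1 * (g p.1.2.1 * h p.1.2.2) := by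
  let e : (Σ x : {x : T × T // x.1 * x.2 = t}, {y : T × T // y.1 * y.2 = x.1.1}) ≃
      {p : T × T × T // p.1 * (p.2.1 * p.2.2) = t} :=
    { toFun := fun x => ⟨(x.2.1.1, x.2.1.2, x.1.1.2), by
        obtain ⟨⟨⟨a, b⟩, h⟩, ⟨⟨c, d⟩, h'⟩⟩ := x
        simp only at h h' ⊢; rw [← mul_assoc, h', h]⟩
      invFun := fun p =>
        ⟨⟨(p.1.1 * p.1.2.1, p.1.2.2), by simpa only [mul_assoc] using p.2⟩,
          ⟨(p.1.1, p.1.2.1), rfl⟩⟩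
      left_inv := by
        rintro ⟨⟨⟨a, b⟩, h⟩, ⟨⟨c, d⟩, h'⟩⟩
        simp only at h h'
        subst h'
        rfl
      right_inv := fun p => rfl }
  have hs : Summable fun p : {p : T × T × T // p.1 * (p.2.1 * p.2.2) = t} =>
      f p.1.1 * (g p.1.2.1 * h p.1.2.2) := (summable_triple f g h).subtype _
  rw [← e.tsum_eq, mul_apply]
  refine Eq.trans (tsum_congr fun x => ?_) (Summable.tsum_sigma (e.summable_iff.2 hs)).symm
  rw [mul_apply, ← tsum_mul_right]
  exact tsum_congr fun y => mul_assoc _ _ _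

/-- `ℓ¹(T)` is a Banach algebra under convolution. -/
instance : NonUnitalNormedRing (EllOne T) :=
  { (inferInstance : NormedAddCommGroup (EllOne T)), (inferInstance : Mul (EllOne T)) with
    left_distrib := fun f g h => ext fun t => by
      simp only [add_apply, mul_apply, mul_add]
      exact (summable_fiber f g t).tsum_add (summable_fiber f h t)
    right_distrib := fun f g h => ext fun t => by
      simp only [add_apply, mul_apply, add_mul]
      exact (summable_fiber f h t).tsum_add (summable_fiber g h t)
    zero_mul := fun f => ext fun t => by simp [mul_apply]
    mul_zero := fun f => ext fun t => by simp [mul_apply]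
    mul_assoc := fun f g h => ext fun t => by rw [mul_assoc_left, mul_assoc_right]
    norm_mul_le := norm_mul_le' }

instance : IsScalarTower ℂ (EllOne T) (EllOne T) where
  smul_assoc c f g := ext fun t => by
    simp only [smul_eq_mul, smul_apply, mul_apply, ← tsum_mul_left, mul_assoc]

instance : SMulCommClass ℂ (EllOne T) (EllOne T) where
  smul_comm c f g := ext fun t => by
    simp only [smul_eq_mul, smul_apply, mul_apply, ← tsum_mul_left, mul_left_comm]

end EllOne

/-! ## Ideals in a semigroup and the minimum ideal -/

/-- A (two-sided) ideal in a semigroup; as usual, ideals are non-empty. -/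
structure IsSemigroupIdeal {T : Type*} [Mul T] (I : Set T) : Prop where
  nonempty : I.Nonempty
  mul_mem_left : ∀ (s : T) {t : T}, t ∈ I → s * t ∈ I
  mul_mem_right : ∀ (s : T) {t : T}, t ∈ I → t * s ∈ I

/-- The minimum ideal `K(T)`, as the intersection of all ideals of `T`. It is the smallest ideal
whenever there is one; see `minIdeal_eq`. -/
def minIdeal (T : Type*) [Mul T] : Set T := ⋂₀ {I | IsSemigroupIdeal I}

theorem minIdeal_eq {T : Type*} [Mul T] {K : Set T}
    (hK : IsLeast {I : Set T | IsSemigroupIdeal I} K) : minIdeal T = K :=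
  Set.Subset.antisymm (Set.sInter_subset_of_mem hK.1) (Set.subset_sInter fun _ hI => hK.2 hI)

/-! ## The semigroup `S* = βS \ S` -/

/-- The product `□` on `βS`: `A ∈ p □ q ↔ {s | {t | s t ∈ A} ∈ q} ∈ p`. It extends the product of
`S`, and `p ↦ p □ q` is continuous for each `q`. -/
instance stoneCechSemigroup (S : Type*) [Semigroup S] : Semigroup (Ultrafilter S) :=
  Ultrafilter.semigroup

/-- The growth `S* = βS \ S` of the discrete space `S`; here `βS` is the space of ultrafilters on
`S`, and `s ∈ S` is identified with the principal ultrafilter at `s`. -/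
def Growth (S : Type*) : Type _ := {p : Ultrafilter S // p ∉ Set.range (pure : S → Ultrafilter S)}

theorem mul_notMem_range_pure {S : Type*} [Semigroup S] [IsCancelMul S] (p : Ultrafilter S)
    {q : Ultrafilter S} (hq : q ∉ Set.range (pure : S → Ultrafilter S)) :
    p * q ∉ Set.range (pure : S → Ultrafilter S) := by
  rintro ⟨s, hs⟩
  have h : ∀ᶠ m in (↑(p * q) : Filter S), m = s := by
    rw [← hs]; simp
  have h' : ∀ᶠ m in (p : Filter S), ∀ᶠ n in (q : Filter S), m * n = s := h
  obtain ⟨m, hm⟩ := h'.exists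
  obtain ⟨n, hn⟩ := hm.exists
  refine hq ⟨n, Ultrafilter.coe_injective (Ultrafilter.unique _ ?_).symm⟩
  simp only [Ultrafilter.coe_pure, Filter.le_pure_iff]
  filter_upwards [hm] with k hk
  exact mul_left_cancel (hk.trans hn.symm)

/-- For cancellative `S`, `S*` is a subsemigroup of `βS`. -/
instance (S : Type*) [Semigroup S] [IsCancelMul S] : Semigroup (Growth S) where
  mul p q := ⟨p.1 * q.1, mul_notMem_range_pure p.1 q.2⟩
  mul_assoc p q r := Subtype.ext (mul_assoc p.1 q.1 r.1)

end

/-!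
Let `x ∈ S*` lie outside the minimum ideal and let `f` be in the radical. The idea is to find a
point `p ∈ S*` such that the products `p c₁ p c₂ ⋯ p cₙ`, with the `cᵢ` in the countable support of
`f`, can be decoded as far as commutativity permits, and then to compare `δ_p ⋆ f` with an element
of `ℓ¹(G)`, where `G` is the group of quotients of `S`.

*The decoding point.* Pass from `S` to `G`, and so from `S*` to a subsemigroup of `βG`. As `G` is
commutative, its elements are central in `βG`, so that `y p (g x) = (y g) p x` for `g ∈ G`;
`Ultrafilter.exists_decoding_point` gives a `p` for which these are the only coincidences
`z p c = y p x` with `c` in the support of `f`. Since `x` is outside some ideal, there is `r ∈ S*`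
such that no closed left ideal `βS r c` contains `x`
(`Growth.exists_avoiding_of_notMem_minIdeal`). This allows the choice of a sequence `t` in `S` so
sparse that each translate of `x` by `h (t n)` has a neighbourhood avoiding the later translates
`h' (t m) c` (`Ultrafilter.exists_sparse`). In the other direction the translates of the points `c`
have to be kept away from the closure of the translates of `x`. That may fail for `t` itself, but
holds for a subsequence, by halving and diagonalization (`Ultrafilter.Sparse.exists_thinning`).
Any limit `p` of the subsequence along a nonprincipal ultrafilter will do: `βG` is an F-space, so
that two countable sets neither of which meets the closure of the other have disjoint closures
(`Ultrafilter.exists_separating`).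
The remaining coincidences are excluded because `G` acts freely on `βG`
(`Ultrafilter.eq_one_of_pure_mul_eq`).

*The algebra.* If `f` is in the radical, then for each `λ ∈ ℂ` there is `b` with
`1 + b = 1 + (1 + b) ⋆ (λ δ_p ⋆ f)`. Let `F ∈ ℓ¹(G)`, `F(g) = f(g x)`. By the choice of `p`, the
restriction of `1 + b` to the `G`-orbit of `(p x)ⁿ` is `λⁿ Fⁿ`
(`EllOne.orbit_mul_delta_mul`), so the norms `‖λⁿ Fⁿ‖` are bounded in `n`. On the other hand the
spectral radius of `F` is at least `|F(1)| = |f(x)|` (`EllOne.norm_apply_one_pow_le`). Taking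
`λ = 2 / f(x)` shows that `f(x) ≠ 0` is impossible. The argument uses no completeness, and applies
to `ℂS*` as well as to `ℓ¹(S*)`.
-/

noncomputable section

open Filter

/-! ### Ultrafilters on a group -/

namespace Ultrafilter

theorem mem_mul_iff {M : Type*} [Semigroup M] {y z : Ultrafilter M} {A : Set M} :
    A ∈ y * z ↔ {a | {b | a * b ∈ A} ∈ z} ∈ y := Iff.rfl

theorem mem_pure_mul_iff {M : Type*} [Semigroup M] {g : M} {z : Ultrafilter M} {A : Set M} :
    A ∈ pure g * z ↔ {b | g * b ∈ A} ∈ z := Iff.rfl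

theorem pure_mul_pure {M : Type*} [Semigroup M] (g h : M) :
    (pure g * pure h : Ultrafilter M) = pure (g * h) := rfl

theorem mul_pure_comm {M : Type*} [CommSemigroup M] (g : M) (y : Ultrafilter M) :
    y * pure g = pure g * y := by
  ext A
  simp only [mem_mul_iff, mem_pure, Set.mem_ofPred_eq, mul_comm]

theorem pure_one_mul {M : Type*} [Monoid M] (y : Ultrafilter M) : pure 1 * y = y := by
  ext A
  simp [mem_pure_mul_iff]

theorem mul_pure_one {M : Type*} [Monoid M] (y : Ultrafilter M) : y * pure 1 = y := by
  ext A
  simp [mem_mul_iff]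

theorem exists_mem_notMem_of_ne {X : Type*} {c d : Ultrafilter X} (h : c ≠ d) :
    ∃ V ∈ c, V ∉ d := by
  by_contra! H
  exact h (coe_injective (c.unique H).symm)

/-- A fixed-point-free translation of a countable group admits a proper colouring with three
colours. The colouring is greedy along an enumeration: each point has only two neighbours. -/
theorem exists_three_coloring {G : Type*} [Group G] [Countable G] {g : G} (hg : g ≠ 1) :
    ∃ c : G → Fin 3, ∀ v, c (g * v) ≠ c v := by
  obtain ⟨idx, hidx⟩ := exists_injective_nat G
  have hf : ∀ a b : Fin 3, ∃ c, c ≠ a ∧ c ≠ b := by decide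
  choose f hf1 hf2 using hf
  let wf : WellFounded (InvImage (· < ·) idx) := InvImage.wf idx Nat.lt_wfRel.wf
  let F : ∀ v, (∀ w, InvImage (· < ·) idx w v → Fin 3) → Fin 3 := fun v r =>
    f (if h : idx (g * v) < idx v then r _ h else 0) (if h : idx (g⁻¹ * v) < idx v then r _ h else 0)
  obtain ⟨c, hc⟩ : ∃ c : G → Fin 3, ∀ v, c v =
      f (if idx (g * v) < idx v then c (g * v) else 0)
        (if idx (g⁻¹ * v) < idx v then c (g⁻¹ * v) else 0) :=
    ⟨wf.fix F, fun v => (wf.fix_eq F v).trans (by simp only [F, dite_eq_ite])⟩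
  refine ⟨c, fun v => ?_⟩
  have hne : idx (g * v) ≠ idx v := fun h => hg (mul_eq_right.1 (hidx h))
  rcases lt_or_gt_of_ne hne with h | h
  · rw [hc v, if_pos h]
    exact (hf1 _ _).symm
  · rw [hc (g * v), inv_mul_cancel_left, if_pos h]
    exact hf2 _ _

/-- A countable group acts freely on its ultrafilters by translation. -/
theorem eq_one_of_pure_mul_eq {G : Type*} [Group G] [Countable G] {g : G} {x : Ultrafilter G}
    (h : pure g * x = x) : g = 1 := by
  by_contra hg
  obtain ⟨c, hc⟩ := exists_three_coloring hg
  obtain ⟨i, hi⟩ := (x.map c).eq_pure_of_finite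
  have h1 : c ⁻¹' {i} ∈ x := by
    rw [← mem_map, hi]; exact Set.mem_singleton i
  have h2 : {b | g * b ∈ c ⁻¹' {i}} ∈ x := mem_pure_mul_iff.1 (h.symm ▸ h1)
  obtain ⟨b, hb1, hb2⟩ := x.nonempty_of_mem (inter_mem h1 h2)
  exact hc b (hb2.trans hb1.symm)

theorem pure_mul_injective {G : Type*} [Group G] [Countable G] (x : Ultrafilter G) :
    Function.Injective fun g : G => pure g * x := by
  intro g h hgh
  have : pure (h⁻¹ * g) * x = x := by
    rw [← pure_mul_pure, mul_assoc, show pure g * x = pure h * x from hgh, ← mul_assoc,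
      pure_mul_pure, inv_mul_cancel, pure_one_mul]
  exact (inv_mul_eq_one.1 (eq_one_of_pure_mul_eq this)).symm

/-! ### Separating countable sets of ultrafilters -/

/-- Two countable sets of ultrafilters, neither of which meets the closure of the other, are
separated by a clopen set: the space of ultrafilters is an F-space. -/
theorem exists_separating {X : Type*} {D E : Set (Ultrafilter X)} (hDc : D.Countable)
    (hEc : E.Countable) (hD : ∀ d ∈ D, ∃ V ∈ d, ∀ e ∈ E, V ∉ e)
    (hE : ∀ e ∈ E, ∃ V ∈ e, ∀ d ∈ D, V ∉ d) :
    ∃ W : Set X, (∀ d ∈ D, W ∈ d) ∧ ∀ e ∈ E, W ∉ e := by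
  have := hDc.to_subtype
  have := hEc.to_subtype
  obtain ⟨a, ha⟩ := exists_injective_nat D
  obtain ⟨b, hb⟩ := exists_injective_nat E
  choose V hV hV' using fun d : D => hD d d.2
  choose V₂ hV₂ hV₂' using fun e : E => hE e e.2
  refine ⟨{x | ∃ d, x ∈ V d ∧ ∀ e, b e ≤ a d → x ∉ V₂ e}, fun d hd => ?_, fun e he hW => ?_⟩
  · have hfin : {e | b e ≤ a ⟨d, hd⟩}.Finite := (Set.finite_Iic _).preimage hb.injOn
    have h1 : (⋂ e ∈ {e | b e ≤ a ⟨d, hd⟩}, (V₂ e)ᶜ) ∈ d :=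
      (biInter_mem hfin).2 fun e _ => compl_mem_iff_notMem.2 (hV₂' e d hd)
    filter_upwards [hV ⟨d, hd⟩, h1] with x hx1 hx2
    exact ⟨⟨d, hd⟩, hx1, fun e h => Set.mem_iInter₂.1 hx2 e h⟩
  · have hfin : {d | a d < b ⟨e, he⟩}.Finite := (Set.finite_Iio _).preimage ha.injOn
    have h1 : (⋃ d ∈ {d | a d < b ⟨e, he⟩}, V d) ∈ e := by
      filter_upwards [hW, hV₂ ⟨e, he⟩] with x ⟨d, hx1, hx2⟩ hx3
      refine Set.mem_iUnion₂.2 ⟨d, ?_, hx1⟩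
      by_contra h
      exact hx2 ⟨e, he⟩ (not_lt.1 h) hx3
    obtain ⟨d, -, hd⟩ := (finite_biUnion_mem_iff hfin).1 h1
    exact hV' d e he hd

theorem exists_avoiding_finite {X : Type*} {L : Set (Ultrafilter X)} (hL : L.Finite)
    {c : Ultrafilter X} (hc : c ∉ L) : ∃ V ∈ c, ∀ d ∈ L, V ∉ d := by
  choose! V hV hV' using fun (d : Ultrafilter X) (hd : d ∈ L) =>
    exists_mem_notMem_of_ne (c := c) (d := d) (fun h => hc (h ▸ hd))
  exact ⟨⋂ d ∈ L, V d, (biInter_mem hL).2 hV, fun d hd h =>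
    hV' d hd (mem_of_superset h (Set.biInter_subset_of_mem hd))⟩

theorem exists_avoiding_levels {X : Type*} {L : ℕ → Set (Ultrafilter X)}
    (hL : ∀ m, (L m).Finite) {c : Ultrafilter X} (hc : ∀ m, c ∉ L m) {V : Set X} (hV : V ∈ c)
    {M : ℕ} (hVM : ∀ m, M ≤ m → ∀ d ∈ L m, V ∉ d) : ∃ V ∈ c, ∀ m, ∀ d ∈ L m, V ∉ d := by
  have hfin : (⋃ m ∈ Set.Iio M, L m).Finite := (Set.finite_Iio M).biUnion fun m _ => hL m
  obtain ⟨V', hV', h⟩ := exists_avoiding_finite hfin (c := c) (by simpa using fun m _ => hc m)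
  refine ⟨V ∩ V', inter_mem hV hV', fun m d hd hd' => ?_⟩
  rcases lt_or_ge m M with hm | hm
  · exact h d (Set.mem_biUnion hm hd) (mem_of_superset hd' Set.inter_subset_right)
  · exact hVM m hm d hd (mem_of_superset hd' Set.inter_subset_left)

end Ultrafilter

theorem Set.Infinite.exists_disjoint_infinite_subsets {N : Set ℕ} (hN : N.Infinite) :
    ∃ N₁ ⊆ N, ∃ N₂ ⊆ N, N₁.Infinite ∧ N₂.Infinite ∧ Disjoint N₁ N₂ := by
  let f := hN.natEmbedding
  have hf : Function.Injective fun n => (f n : ℕ) := Subtype.val_injective.comp f.injective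
  refine ⟨Set.range fun n => (f (2 * n) : ℕ), ?_, Set.range fun n => (f (2 * n + 1) : ℕ), ?_,
    Set.infinite_range_of_injective fun a b h => ?_,
    Set.infinite_range_of_injective fun a b h => ?_, ?_⟩
  · rintro _ ⟨n, rfl⟩; exact (f _).2
  · rintro _ ⟨n, rfl⟩; exact (f _).2
  · have := hf h; omega
  · have := hf h; omega
  · rw [Set.disjoint_left]
    rintro _ ⟨a, rfl⟩ ⟨b, h⟩
    have := hf h; omega

/-- Diagonal argument: if for every `i` each infinite set of natural numbers has an infinite subset
with the property `Q i`, then some sequence is, for every `i`, eventually in a set with `Q i`. -/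
theorem exists_strictMono_diagonal (Q : ℕ → Set ℕ → Prop)
    (h : ∀ i (N : Set ℕ), N.Infinite → ∃ N' ⊆ N, N'.Infinite ∧ Q i N') :
    ∃ φ : ℕ → ℕ, StrictMono φ ∧ ∀ i, ∃ N, Q i N ∧ ∀ m, i ≤ m → φ m ∈ N := by
  choose! F hF1 hF2 hF3 using h
  let N : ℕ → Set ℕ := fun n => Nat.rec (F 0 Set.univ) (fun i M => F (i + 1) M) n
  have hN : ∀ n, (N n).Infinite := fun n => by
    induction n with
    | zero => exact hF2 _ _ Set.infinite_univ
    | succ n ih => exact hF2 _ _ ih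
  have hQ : ∀ n, Q n (N n) := fun n => by
    cases n with
    | zero => exact hF3 _ _ Set.infinite_univ
    | succ n => exact hF3 _ _ (hN n)
  have hanti : Antitone N := antitone_nat_of_succ_le fun n => hF1 _ _ (hN n)
  obtain ⟨φ, hφ, hφN⟩ := extraction_forall_of_frequently (P := fun n k => k ∈ N n)
    fun n => Nat.frequently_atTop_iff_infinite.2 (hN n)
  exact ⟨φ, hφ, fun i => ⟨N i, hQ i, fun m hm => hanti hm (hφN m)⟩⟩

/-! ### A point that decodes products -/

namespace Ultrafilter

variable {G : Type*} [CommGroup G]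

/-- The `m`-th level of translates `h t c` of an ultrafilter `c`, where `h` runs over the first
`m + 1` elements of a subset `Y` of the enumerated group. -/
def level (idx : G → ℕ) (t : ℕ → G) (Y : Set G) (c : Ultrafilter G) (m : ℕ) :
    Set (Ultrafilter G) :=
  {d | ∃ h ∈ Y, idx h ≤ m ∧ pure (h * t m) * c = d}

theorem level_finite {idx : G → ℕ} (hidx : Function.Injective idx) (t : ℕ → G) (Y : Set G)
    (c : Ultrafilter G) (m : ℕ) : (level idx t Y c m).Finite := by
  refine (((Set.finite_Iic m).preimage hidx.injOn).image fun h => pure (h * t m) * c).subset ?_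
  rintro _ ⟨h, -, hm, rfl⟩
  exact ⟨h, hm, rfl⟩

/-- The sparseness of a sequence `t` that is used to separate translates of `x` from translates
of the `C k`: every set `A k ∈ x`, moved by `g (t n)`, is avoided by `h (t m) (C k)` for all `m`
that are large compared with `g`, `h`, `n` and `k`. -/
def Sparse (idx : G → ℕ) (A : ℕ → Set G) (C : ℕ → Ultrafilter G) (t : ℕ → G) : Prop :=
  ∀ n m, n < m → ∀ k ≤ m, ∀ g h, idx g ≤ m → idx h ≤ m →
    A k ∉ pure ((g * t n)⁻¹ * (h * t m)) * C k

theorem exists_sparse {idx : G → ℕ} (hidx : Function.Injective idx) {A : ℕ → Set G}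
    {C : ℕ → Ultrafilter G} {T : Set G}
    (hT : ∀ (F : Finset G) (N : ℕ), ∃ u ∈ T, ∀ k ≤ N, ∀ g ∈ F, A k ∉ pure (g * u) * C k) :
    ∃ t : ℕ → G, (∀ m, t m ∈ T) ∧ Sparse idx A C t := by
  classical
  have hfin : ∀ m, {g | idx g ≤ m}.Finite := fun m => (Set.finite_Iic m).preimage hidx.injOn
  obtain ⟨f, hfP, hf⟩ := exists_seq_of_forall_finset_exists
    (fun a : ℕ × G => a.2 ∈ T) (fun a b => a.1 < b.1 ∧ ∀ k ≤ b.1, ∀ g h, idx g ≤ b.1 →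
      idx h ≤ b.1 → A k ∉ pure ((g * a.2)⁻¹ * (h * b.2)) * C k) (fun s _ => by
    let b := s.sup Prod.fst + 1
    let E := (hfin b).toFinset
    obtain ⟨u, huT, hu⟩ := hT
      (Finset.image (fun q : (G × G) × (ℕ × G) => (q.1.1 * q.2.2)⁻¹ * q.1.2) ((E ×ˢ E) ×ˢ s)) b
    refine ⟨(b, u), huT, fun a ha => ⟨Nat.lt_succ_of_le (Finset.le_sup (f := Prod.fst) ha),
      fun k hk g h hg hh => ?_⟩⟩
    rw [← mul_assoc]
    refine hu k hk _ (Finset.mem_image.2 ⟨((g, h), a), ?_, rfl⟩)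
    simp only [Finset.mem_product, E, Set.Finite.mem_toFinset]
    exact ⟨⟨hg, hh⟩, ha⟩)
  have hmono : StrictMono fun n => (f n).1 := fun m n h => (hf m n h).1
  refine ⟨fun n => (f n).2, hfP, fun n m hnm k hk g h hg hh => ?_⟩
  have := hmono.le_apply (x := m)
  exact (hf n m hnm).2 k (hk.trans this) g h (hg.trans this) (hh.trans this)

variable {idx : G → ℕ} {A : ℕ → Set G} {C : ℕ → Ultrafilter G} {t : ℕ → G}

theorem Sparse.comp (ht : Sparse idx A C t) {φ : ℕ → ℕ} (hφ : StrictMono φ) :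
    Sparse idx A C (t ∘ φ) := fun n m hnm k hk g h hg hh =>
  ht (φ n) (φ m) (hφ hnm) k (hk.trans hφ.le_apply) g h (hg.trans hφ.le_apply)
    (hh.trans hφ.le_apply)

theorem Sparse.exists_avoiding_tail (ht : Sparse idx A C t) {x : Ultrafilter G}
    (hA : ∀ k, A k ∈ x) (g : G) (n k : ℕ) :
    ∃ V ∈ pure (g * t n) * x, ∀ m, n < m → idx g ≤ m → k ≤ m →
      ∀ Y, ∀ d ∈ level idx t Y (C k) m, V ∉ d := by
  refine ⟨{b | (g * t n)⁻¹ * b ∈ A k}, ?_, ?_⟩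
  · rw [mem_pure_mul_iff]
    simp only [Set.mem_ofPred_eq, inv_mul_cancel_left]
    exact hA k
  · rintro m hnm hg hk Y _ ⟨h, -, hh, rfl⟩ hV
    refine ht n m hnm k hk g h hg hh ?_
    rw [mem_pure_mul_iff] at hV ⊢
    simpa only [Set.mem_ofPred_eq, mul_assoc] using hV

theorem Sparse.disjoint_level (ht : Sparse idx A C t) {x : Ultrafilter G}
    (hA : ∀ k, A k ∈ x) (hC : C 0 = x) {n m : ℕ} (hnm : n < m) {Y Z : Set G} {d : Ultrafilter G}
    (hd : d ∈ level idx t Y x n) : d ∉ level idx t Z x m := by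
  intro hd'
  obtain ⟨g, -, hg, rfl⟩ := hd
  obtain ⟨V, hV, h⟩ := ht.exists_avoiding_tail hA g n 0
  rw [hC] at h
  exact h m hnm (hg.trans hnm.le) (Nat.zero_le _) Z _ hd' hV

/-- Given any ultrafilter `c`, an infinite set of levels of translates of `x` may be thinned out
so that `c` is outside the closure of what remains: the levels in two disjoint infinite sets are
separated by a clopen set, and `c` is on one of its sides. -/
theorem Sparse.exists_thinning (hidx : Function.Injective idx) (ht : Sparse idx A C t)
    {x : Ultrafilter G} (hA : ∀ k, A k ∈ x) (hC : C 0 = x) (c : Ultrafilter G) (N : Set ℕ)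
    (hN : N.Infinite) : ∃ N' ⊆ N, N'.Infinite ∧
      ∃ B ∈ c, ∀ m ∈ N', ∀ d ∈ level idx t Set.univ x m, B ∉ d := by
  obtain ⟨N₁, h₁, N₂, h₂, hi₁, hi₂, hdisj⟩ := hN.exists_disjoint_infinite_subsets
  let L := level idx t Set.univ x
  have hL : ∀ m, (L m).Finite := level_finite hidx t _ x
  -- A point of one level is separated from all levels of a set of levels not containing its own.
  have key : ∀ N₁ N₂ : Set ℕ, Disjoint N₁ N₂ →
      ∀ d ∈ ⋃ m ∈ N₁, L m, ∃ V ∈ d, ∀ e ∈ ⋃ m ∈ N₂, L m, V ∉ e := by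
    intro N₁ N₂ hdisj d hd
    obtain ⟨n, hn, hd⟩ := Set.mem_iUnion₂.1 hd
    obtain ⟨g, -, hg, hgd⟩ := id hd
    obtain ⟨V, hV, hVt⟩ := ht.exists_avoiding_tail hA g n 0
    rw [hC] at hVt
    rw [hgd] at hV
    have hdL : ∀ m, d ∉ {e ∈ L m | m ∈ N₂} := fun m hm => by
      rcases lt_trichotomy n m with h | rfl | h
      · exact ht.disjoint_level hA hC h hd hm.1
      · exact Set.disjoint_left.1 hdisj hn hm.2
      · exact ht.disjoint_level hA hC h hm.1 hd
    obtain ⟨W, hW, hWL⟩ := exists_avoiding_levels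
      (fun m => (hL m).subset (Set.sep_subset _ _)) hdL hV (M := n + 1)
      (fun m hm e he => hVt m hm (by omega) (Nat.zero_le _) _ e he.1)
    refine ⟨W, hW, fun e he => ?_⟩
    obtain ⟨m, hm, he⟩ := Set.mem_iUnion₂.1 he
    exact hWL m e ⟨he, hm⟩
  have hcount : ∀ N : Set ℕ, (⋃ m ∈ N, L m).Countable := fun N =>
    N.to_countable.biUnion fun m _ => (hL m).countable
  obtain ⟨W, hW₁, hW₂⟩ := exists_separating (hcount N₁) (hcount N₂) (key _ _ hdisj)
    (key _ _ hdisj.symm)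
  by_cases hWc : W ∈ c
  · exact ⟨N₂, h₂, hi₂, W, hWc, fun m hm d hd => hW₂ d (Set.mem_biUnion hm hd)⟩
  · exact ⟨N₁, h₁, hi₁, Wᶜ, compl_mem_iff_notMem.2 hWc, fun m hm d hd =>
      compl_notMem_iff.2 (hW₁ d (Set.mem_biUnion hm hd))⟩

/-- With `p = lim t` along `U`, the product `y p a` is in the closure of the translates
`h (t m) a`, `h ∈ Y`, whose index `m` is large compared with `h`, and likewise for `z p b`. If
neither of these two countable sets meets the closure of the other, then `y p a ≠ z p b`. -/
theorem mul_map_mul_ne (hidx : Function.Injective idx) {U : Ultrafilter ℕ}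
    (hU : ∀ M, Set.Ici M ∈ U) {y z a b : Ultrafilter G} {Y Z : Set G} (hY : Y ∈ y) (hZ : Z ∈ z)
    (hD : ∀ n, ∀ d ∈ level idx t Y a n, ∃ V ∈ d, ∀ m, ∀ e ∈ level idx t Z b m, V ∉ e)
    (hE : ∀ n, ∀ e ∈ level idx t Z b n, ∃ V ∈ e, ∀ m, ∀ d ∈ level idx t Y a m, V ∉ d) :
    y * U.map t * a ≠ z * U.map t * b := by
  have hcount : ∀ Y c, (⋃ m, level idx t Y c m).Countable := fun Y c =>
    Set.countable_iUnion fun m => (level_finite hidx t Y c m).countable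
  obtain ⟨W, hW₁, hW₂⟩ := exists_separating (hcount Y a) (hcount Z b)
    (fun d hd => by
      obtain ⟨n, hn⟩ := Set.mem_iUnion.1 hd
      obtain ⟨V, hV, h⟩ := hD n d hn
      exact ⟨V, hV, fun e he => by obtain ⟨m, hm⟩ := Set.mem_iUnion.1 he; exact h m e hm⟩)
    (fun d hd => by
      obtain ⟨n, hn⟩ := Set.mem_iUnion.1 hd
      obtain ⟨V, hV, h⟩ := hE n d hn
      exact ⟨V, hV, fun e he => by obtain ⟨m, hm⟩ := Set.mem_iUnion.1 he; exact h m e hm⟩)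
  have hmem : ∀ (y a : Ultrafilter G) (W : Set G), W ∈ y * U.map t * a ↔
      ∀ᶠ h in y, ∀ᶠ m in U, W ∈ pure (h * t m) * a := fun y a W => Iff.rfl
  intro h
  have h1 : W ∈ y * U.map t * a := by
    rw [hmem]
    filter_upwards [hY] with h hh
    filter_upwards [hU (idx h)] with m hm
    exact hW₁ _ (Set.mem_iUnion.2 ⟨m, h, hh, hm, rfl⟩)
  have h2 : Wᶜ ∈ z * U.map t * b := by
    rw [hmem]
    filter_upwards [hZ] with h hh
    filter_upwards [hU (idx h)] with m hm
    exact compl_mem_iff_notMem.2 (hW₂ _ (Set.mem_iUnion.2 ⟨m, h, hh, hm, rfl⟩))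
  exact compl_mem_iff_notMem.1 h2 (h ▸ h1)

/-- The key combinatorial fact. Suppose that `x` is outside the closure of suitable families of
translates of the `C k`, uniformly over finite sets of translations. Then there is a nonprincipal
`p` such that an equation `y p x = z p (C k)` has only the evident solutions, which exist because
elements of `G` are central. -/
theorem exists_decoding_point [Countable G] {x : Ultrafilter G} (hC : C 0 = x)
    (hA : ∀ k, A k ∈ x) {T : Set G}
    (hT : ∀ (F : Finset G) (N : ℕ), ∃ u ∈ T, ∀ k ≤ N, ∀ g ∈ F, A k ∉ pure (g * u) * C k) :
    ∃ p : Ultrafilter G, T ∈ p ∧ p ∉ Set.range (pure : G → Ultrafilter G) ∧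
      ∀ (y z : Ultrafilter G) (k : ℕ), y * p * x = z * p * C k →
        ∃ g, C k = pure g * x ∧ y = z * pure g := by
  obtain ⟨idx, hidx⟩ := exists_injective_nat G
  obtain ⟨t₀, ht₀T, ht₀⟩ := exists_sparse hidx hT
  obtain ⟨e, he⟩ := exists_surjective_nat (G × ℕ)
  -- Thin out the sequence once for each of the countably many translates of the `C k`.
  obtain ⟨φ, hφ, hQ⟩ := exists_strictMono_diagonal
    (fun i N => ∃ B ∈ pure (e i).1 * C (e i).2, ∀ m ∈ N,
      ∀ d ∈ level idx t₀ Set.univ x m, B ∉ d)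
    (fun i N hN => ht₀.exists_thinning hidx hA hC _ N hN)
  let t := t₀ ∘ φ
  have ht : Sparse idx A C t := ht₀.comp hφ
  have hthin : ∀ g k, ∃ M, ∃ B ∈ pure g * C k, ∀ m, M ≤ m →
      ∀ d ∈ level idx t Set.univ x m, B ∉ d := by
    intro g k
    obtain ⟨i, hi⟩ := he (g, k)
    obtain ⟨N, ⟨B, hB, hBN⟩, hN⟩ := hQ i
    rw [hi] at hB
    refine ⟨i, B, hB, ?_⟩
    rintro m hm _ ⟨h, -, hh, rfl⟩
    exact hBN _ (hN m hm) _ ⟨h, trivial, hh.trans hφ.le_apply, rfl⟩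
  let U : Ultrafilter ℕ := hyperfilter ℕ
  have hU : ∀ M, Set.Ici M ∈ U := fun M => by
    have : Set.Ici M ∈ (atTop : Filter ℕ) := Ici_mem_atTop M
    exact Nat.hyperfilter_le_atTop this
  refine ⟨U.map t, mem_map.2 (univ_mem' fun m => ht₀T _), ?_, fun y z k hyz => ?_⟩
  · rintro ⟨g, hg⟩
    have h1 : t ⁻¹' {g} ∈ U := by
      rw [← mem_map, ← hg]; exact Set.mem_singleton g
    obtain ⟨n, hn, hn1⟩ := U.nonempty_of_mem (inter_mem h1 (hU (idx 1)))
    obtain ⟨m, hm, hm1⟩ := U.nonempty_of_mem (inter_mem h1 (hU (n + 1)))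
    have hn' : t n = g := hn
    have hm' : t m = g := hm
    simp only [Set.mem_Ici] at hn1 hm1
    have := ht n m hm1 0 (Nat.zero_le _) 1 1 (by omega) (by omega)
    rw [hn', hm', hC, inv_mul_cancel, pure_one_mul] at this
    exact this (hA 0)
  · by_cases hk : ∃ g, C k = pure g * x
    · obtain ⟨g, hg⟩ := hk
      refine ⟨g, hg, ?_⟩
      by_contra hne
      obtain ⟨Y, hY, hYz⟩ := exists_mem_notMem_of_ne hne
      have hsep : ∀ (Y Z : Set G), Disjoint Y Z → ∀ n, ∀ d ∈ level idx t Y x n,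
          ∃ V ∈ d, ∀ m, ∀ e ∈ level idx t Z x m, V ∉ e := by
        intro Y Z hdisj n d hd
        obtain ⟨a, haY, ha, had⟩ := id hd
        obtain ⟨V, hV, h⟩ := ht.exists_avoiding_tail hA a n 0
        rw [hC] at h
        rw [had] at hV
        refine exists_avoiding_levels (level_finite hidx t Z x) (fun m hm => ?_) hV (M := n + 1)
          (fun m hm e he => h m hm (by omega) (Nat.zero_le _) _ e he)
        rcases lt_trichotomy n m with h | rfl | h
        · exact ht.disjoint_level hA hC h hd hm
        · obtain ⟨b, hbZ, -, hbd⟩ := hm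
          have hab := mul_right_cancel (pure_mul_injective x (had.trans hbd.symm))
          exact Set.disjoint_left.1 hdisj haY (hab ▸ hbZ)
        · exact ht.disjoint_level hA hC h hm hd
      -- Now `y p x = (z g) p x`, while disjoint sets of translations give disjoint sets of
      -- translates of `x`, because the action on the orbit of `x` is free.
      refine mul_map_mul_ne hidx hU hY (compl_mem_iff_notMem.2 hYz)
        (hsep Y Yᶜ disjoint_compl_right) (hsep Yᶜ Y disjoint_compl_left) (hyz.trans ?_)
      rw [hg, ← mul_assoc, mul_assoc z, mul_pure_comm, ← mul_assoc]
    · -- No translate of `C k` is a translate of `x`. The sparseness of `t` keeps translates of `x`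
      -- away from the later translates of `C k`, and the thinning does the converse.
      refine absurd hyz (mul_map_mul_ne hidx hU (Y := Set.univ) (Z := Set.univ) univ_mem univ_mem
        (fun n d hd => ?_) (fun n c hc => ?_))
      · obtain ⟨a, haY, ha, had⟩ := id hd
        obtain ⟨V, hV, h⟩ := ht.exists_avoiding_tail hA a n k
        rw [had] at hV
        refine exists_avoiding_levels (level_finite hidx t _ _) (fun m hm => hk ?_) hV
          (M := n + k + 1) (fun m hm e he => h m (by omega) (by omega) (by omega) _ e he)
        obtain ⟨b, -, -, hbd⟩ := hm
        refine ⟨(b * t m)⁻¹ * (a * t n), ?_⟩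
        rw [← pure_mul_pure, mul_assoc, had, ← hbd, ← mul_assoc, pure_mul_pure, inv_mul_cancel,
          pure_one_mul]
      · obtain ⟨b, -, -, rfl⟩ := hc
        obtain ⟨M, B, hB, h⟩ := hthin (b * t n) k
        refine exists_avoiding_levels (level_finite hidx t _ _) (fun m hm => hk ?_) hB h
        obtain ⟨a, -, -, had⟩ := hm
        refine ⟨(b * t n)⁻¹ * (a * t m), ?_⟩
        rw [← pure_mul_pure, mul_assoc, had, ← mul_assoc, pure_mul_pure, inv_mul_cancel,
          pure_one_mul]

end Ultrafilter

/-! ### Convolution algebras -/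

namespace EllOne

variable {T T' : Type*}

attribute [ext] EllOne.ext

open scoped Classical in
/-- The point mass at `t`. -/
def delta (t : T) : EllOne T :=
  mk (fun u => if u = t then 1 else 0) (summable_of_ne_finset_zero (s := {t}) fun u hu => by
    simp [Finset.notMem_singleton.1 hu])

@[simp] theorem delta_self (t : T) : delta t t = 1 := by simp [delta]

theorem delta_of_ne {s t : T} (h : s ≠ t) : delta t s = 0 := by simp [delta, h]

theorem norm_apply_le (f : EllOne T) (t : T) : ‖f t‖ ≤ ‖f‖ := by
  rw [norm_eq]
  exact f.summable_norm.le_tsum t fun _ _ => norm_nonneg _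

/-- The restriction of a function along an injective map. -/
def comap (e : T → T') (he : Function.Injective e) (f : EllOne T') : EllOne T :=
  mk (fun t => f (e t)) (f.summable_norm.comp_injective he)

theorem norm_comap_le (e : T → T') (he : Function.Injective e) (f : EllOne T') :
    ‖comap e he f‖ ≤ ‖f‖ := by
  rw [norm_eq, norm_eq]
  exact tsum_comp_le_tsum_of_inj f.summable_norm (fun _ => norm_nonneg _) he

section Semigroup

variable [Semigroup T] [Semigroup T']

theorem delta_mul_delta (s t : T) : delta s * delta t = delta (s * t) := by
  ext u
  rw [mul_apply]
  have hz : ∀ p : {p : T × T // p.1 * p.2 = u}, p.1 ≠ (s, t) →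
      delta s p.1.1 * delta t p.1.2 = 0 := fun p hp => by
    by_cases h : p.1.1 = s
    · rw [delta_of_ne (s := p.1.2) fun h' => hp (Prod.ext h h'), mul_zero]
    · rw [delta_of_ne h, zero_mul]
  by_cases h : s * t = u
  · subst h
    rw [tsum_eq_single ⟨(s, t), rfl⟩ fun p hp => hz p fun h => hp (Subtype.ext h)]
    simp
  · rw [delta_of_ne fun h' => h h'.symm]
    exact (tsum_congr fun p => hz p fun h' => h (by rw [← p.2, h'])).trans tsum_zero

theorem delta_mul_of_left_identity {e : T} (he : ∀ t, e * t = t) (f : EllOne T) :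
    delta e * f = f := by
  ext u
  rw [mul_apply, tsum_eq_single ⟨(e, u), he u⟩ fun p hp => ?_]
  · simp
  · rw [delta_of_ne fun h => hp ?_, zero_mul]
    have := p.2
    rw [h, he] at this
    exact Subtype.ext (Prod.ext h this)

/-- The algebra homomorphism of convolution algebras induced by an injective homomorphism of
semigroups: extension by zero. -/
def map (j : T →ₙ* T') (hj : Function.Injective j) : EllOne T →ₙₐ[ℂ] EllOne T' where
  toFun f := mk (Function.extend j f 0) (by
    refine (hj.summable_iff fun u hu => ?_).1 ?_
    · rw [Function.extend_apply' _ _ _ hu, Pi.zero_apply, norm_zero]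
    · simpa [Function.comp_def, hj.extend_apply] using f.summable_norm)
  map_smul' c f := by
    ext u
    by_cases hu : ∃ t, j t = u
    · obtain ⟨t, rfl⟩ := hu
      simp [hj.extend_apply]
    · simp [Function.extend_apply' _ _ _ hu]
  map_zero' := by
    ext u
    by_cases hu : ∃ t, j t = u
    · obtain ⟨t, rfl⟩ := hu
      simp [hj.extend_apply]
    · simp [Function.extend_apply' _ _ _ hu]
  map_add' f g := by
    ext u
    by_cases hu : ∃ t, j t = u
    · obtain ⟨t, rfl⟩ := hu
      simp [hj.extend_apply]
    · simp [Function.extend_apply' _ _ _ hu]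
  map_mul' f g := by
    ext u
    rw [mk_apply, mul_apply]
    have hsupp : ∀ p : T' × T',
        Function.extend j f 0 p.1 * Function.extend j g 0 p.2 ≠ 0 →
        ∃ q : T × T, j q.1 = p.1 ∧ j q.2 = p.2 := fun p hp => by
      by_contra! H
      by_cases h1 : ∃ t, j t = p.1
      · obtain ⟨s, hs⟩ := h1
        refine right_ne_zero_of_mul hp (Function.extend_apply' _ _ _ ?_)
        rintro ⟨t, ht⟩
        exact H (s, t) hs ht
      · exact left_ne_zero_of_mul hp (Function.extend_apply' _ _ _ h1)
    by_cases hu : ∃ t, j t = u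
    · obtain ⟨t, rfl⟩ := hu
      rw [hj.extend_apply, mul_apply]
      let e : {q : T × T // q.1 * q.2 = t} → {p : T' × T' // p.1 * p.2 = j t} :=
        fun q => ⟨(j q.1.1, j q.1.2), by rw [← map_mul, q.2]⟩
      have he : Function.Injective e := fun q q' h => by
        have h' := Prod.ext_iff.1 (congrArg Subtype.val h)
        exact Subtype.ext (Prod.ext (hj h'.1) (hj h'.2))
      rw [← he.tsum_eq fun p hp => ?_]
      · exact tsum_congr fun q => by simp [e, hj.extend_apply]
      · obtain ⟨q, h1, h2⟩ := hsupp p.1 hp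
        refine ⟨⟨q, hj ?_⟩, Subtype.ext (Prod.ext h1 h2)⟩
        rw [map_mul, h1, h2, p.2]
    · rw [Function.extend_apply' _ _ _ hu]
      refine ((tsum_congr fun p => ?_).trans tsum_zero).symm
      by_contra hp
      obtain ⟨q, h1, h2⟩ := hsupp p.1 hp
      exact hu ⟨q.1 * q.2, by rw [map_mul, h1, h2, p.2]⟩

theorem map_apply (j : T →ₙ* T') (hj : Function.Injective j) (f : EllOne T) (t : T) :
    map j hj f (j t) = f t := hj.extend_apply _ _ _

theorem map_apply_of_notMem (j : T →ₙ* T') (hj : Function.Injective j) (f : EllOne T) {u : T'}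
    (hu : u ∉ Set.range j) : map j hj f u = 0 := Function.extend_apply' _ _ _ hu

theorem map_delta (j : T →ₙ* T') (hj : Function.Injective j) (t : T) :
    map j hj (delta t) = delta (j t) := by
  ext u
  by_cases hu : u ∈ Set.range j
  · obtain ⟨s, rfl⟩ := hu
    rw [map_apply]
    by_cases h : s = t
    · simp [h]
    · rw [delta_of_ne h, delta_of_ne (hj.ne h)]
  · rw [map_apply_of_notMem _ _ _ hu, delta_of_ne fun h => hu ⟨t, h.symm⟩]

variable (T) in
/-- The inclusion of the semigroup algebra in the convolution algebra. -/
def ofMonoidAlgebra : MonoidAlgebra ℂ T →ₙₐ[ℂ] EllOne T :=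
  MonoidAlgebra.liftMagma ℂ
    { toFun := delta, map_mul' := fun s t => (delta_mul_delta s t).symm }

theorem ofMonoidAlgebra_single (t : T) (c : ℂ) :
    ofMonoidAlgebra T (MonoidAlgebra.single t c) = c • delta t := by
  simp [ofMonoidAlgebra]

theorem ofMonoidAlgebra_apply (f : MonoidAlgebra ℂ T) (t : T) :
    ofMonoidAlgebra T f t = f.coeff t := by
  induction f using MonoidAlgebra.induction_linear with
  | zero => simp
  | add f g hf hg => simp [hf, hg]
  | single s c =>
    rw [ofMonoidAlgebra_single, smul_apply]
    by_cases h : t = s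
    · simp [h]
    · simp [delta_of_ne h, Finsupp.single_eq_of_ne h]

end Semigroup

instance (T : Type*) [CommMonoid T] : CommRing (EllOne T) :=
  have hcomm : ∀ f g : EllOne T, f * g = g * f := fun f g => by
    ext t
    rw [mul_apply, mul_apply]
    let e : {p : T × T // p.1 * p.2 = t} ≃ {p : T × T // p.1 * p.2 = t} :=
      (Equiv.prodComm T T).subtypeEquiv fun p => by simp [mul_comm]
    rw [← e.tsum_eq]
    exact tsum_congr fun p => mul_comm _ _
  { (inferInstance : NonUnitalNormedRing (EllOne T)) with
    one := delta 1
    one_mul := delta_mul_of_left_identity one_mul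
    mul_one := fun f => (hcomm f _).trans (delta_mul_of_left_identity one_mul f)
    mul_comm := hcomm }

theorem one_def (T : Type*) [CommMonoid T] : (1 : EllOne T) = delta 1 := rfl

section Group

variable {G : Type*} [CommGroup G]

/-- The involution `f ↦ f*`, `f*(g) = conj (f (g⁻¹))`, of the convolution algebra of a group. -/
def adj (f : EllOne G) : EllOne G :=
  mk (fun g => starRingEnd ℂ (f g⁻¹)) (by
    simpa [Function.comp_def] using (Equiv.inv G).summable_iff.2 f.summable_norm)

theorem adj_apply (f : EllOne G) (g : G) : adj f g = starRingEnd ℂ (f g⁻¹) := rfl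

theorem adj_adj (f : EllOne G) : adj (adj f) = f := by
  ext g
  simp [adj_apply]

theorem norm_adj (f : EllOne G) : ‖adj f‖ = ‖f‖ := by
  rw [norm_eq, norm_eq, ← (Equiv.inv G).tsum_eq]
  simp [adj_apply]

theorem adj_mul (f g : EllOne G) : adj (f * g) = adj f * adj g := by
  ext t
  rw [adj_apply, mul_apply, mul_apply, Complex.conj_tsum]
  let e : {p : G × G // p.1 * p.2 = t} ≃ {p : G × G // p.1 * p.2 = t⁻¹} :=
    ((Equiv.inv G).prodCongr (Equiv.inv G)).subtypeEquiv fun p => by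
      change _ ↔ p.1⁻¹ * p.2⁻¹ = t⁻¹
      rw [← mul_inv, inv_inj]
  rw [← e.tsum_eq]
  exact tsum_congr fun p => map_mul _ _ _

theorem adj_one : adj (1 : EllOne G) = 1 := by
  ext g
  rw [adj_apply, one_def]
  by_cases h : g = 1
  · simp [h]
  · rw [delta_of_ne h, delta_of_ne (inv_ne_one.2 h), map_zero]

theorem adj_pow (f : EllOne G) (n : ℕ) : adj (f ^ n) = adj f ^ n := by
  induction n with
  | zero => simp [adj_one]
  | succ n ih => rw [pow_succ, adj_mul, ih, pow_succ]

/-- The value of `f* ⋆ f` at the identity is `∑ |f(g)|²`. -/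
theorem sq_norm_apply_one_le (f : EllOne G) : ‖f 1‖ ^ 2 ≤ ‖(adj f * f) 1‖ := by
  let e : G ≃ {p : G × G // p.1 * p.2 = 1} :=
    { toFun := fun g => ⟨(g⁻¹, g), inv_mul_cancel g⟩
      invFun := fun p => p.1.2
      left_inv := fun g => rfl
      right_inv := fun p => Subtype.ext (Prod.ext (eq_inv_of_mul_eq_one_left p.2).symm rfl) }
  have h1 : (adj f * f) 1 = ((∑' g, ‖f g‖ ^ 2 : ℝ) : ℂ) := by
    rw [mul_apply, ← e.tsum_eq, Complex.ofReal_tsum]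
    refine tsum_congr fun g => ?_
    simp [e, adj_apply, Complex.conj_mul']
  have hs : Summable fun g => ‖f g‖ ^ 2 := by
    refine .of_nonneg_of_le (fun _ => sq_nonneg _) (fun g => ?_) (f.summable_norm.mul_left ‖f‖)
    rw [sq]
    exact mul_le_mul_of_nonneg_right (norm_apply_le f g) (norm_nonneg _)
  rw [h1, Complex.norm_of_nonneg (tsum_nonneg fun _ => sq_nonneg _)]
  exact hs.le_tsum 1 fun _ _ => sq_nonneg _

/-- A quantitative form of the semisimplicity of the convolution algebra of an abelian group: the
spectral radius of `f` is at least `|f(1)|`. For the self-adjoint `H = f* ⋆ f`, the numbers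
`|H^(2^k)(1)|` at least square from each `k` to the next. -/
theorem norm_apply_one_pow_le (f : EllOne G) (k : ℕ) : ‖f 1‖ ^ 2 ^ k ≤ ‖f ^ 2 ^ k‖ := by
  have hadj : ∀ n, adj ((adj f * f) ^ n) = (adj f * f) ^ n := fun n => by
    rw [adj_pow, adj_mul, adj_adj, mul_comm]
  have h1 : (‖f 1‖ ^ 2 ^ k) ^ 2 ≤ ‖((adj f * f) ^ 2 ^ k) 1‖ := by
    induction k with
    | zero => simpa using sq_norm_apply_one_le f
    | succ k ih =>
      have h2 := sq_norm_apply_one_le ((adj f * f) ^ 2 ^ k)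
      rw [hadj, ← pow_two, ← pow_mul, ← pow_succ] at h2
      refine le_trans ?_ h2
      rw [pow_succ 2 k, pow_mul ‖f 1‖]
      gcongr
  refine (pow_le_pow_iff_left₀ (by positivity) (norm_nonneg _) two_ne_zero).1 (h1.trans ?_)
  refine (norm_apply_le _ _).trans ?_
  rw [mul_pow, ← adj_pow, pow_two]
  exact (norm_mul_le' _ _).trans_eq (by rw [norm_adj])

end Group

end EllOne

/-! ### Quasi-inverses in the convolution algebra of `βG` -/

namespace EllOne

variable {G : Type*} [CommGroup G] [Countable G]

/-- The restriction of a function on `βG` to the orbit of `u` under `G`, as a function on `G`. -/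
def orbit (u : Ultrafilter G) : EllOne (Ultrafilter G) → EllOne G :=
  comap (fun g => pure g * u) (Ultrafilter.pure_mul_injective u)

theorem orbit_apply (u : Ultrafilter G) (f : EllOne (Ultrafilter G)) (g : G) :
    orbit u f g = f (pure g * u) := rfl

/-- If the only solutions of `y p x = z p c` with `c` in the support of `f` are the evident ones,
then on orbits of products ending in `p x`, right multiplication by `δ_p ⋆ f` is convolution
with the restriction of `f` to the orbit of `x`. -/
theorem orbit_mul_delta_mul {p x : Ultrafilter G} {f : EllOne (Ultrafilter G)}
    (hp : ∀ y z c : Ultrafilter G, f c ≠ 0 → y * p * x = z * p * c →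
      ∃ g, c = pure g * x ∧ y = z * pure g)
    (b : EllOne (Ultrafilter G)) (w : Ultrafilter G) :
    orbit (w * p * x) (b * (delta p * f)) = orbit w b * orbit x f := by
  ext g
  rw [orbit_apply, mul_assoc_left, mul_apply]
  let e : {q : G × G // q.1 * q.2 = g} →
      {q : Ultrafilter G × Ultrafilter G × Ultrafilter G //
        q.1 * (q.2.1 * q.2.2) = pure g * (w * p * x)} :=
    fun q => ⟨(pure q.1.1 * w, p, pure q.1.2 * x), by
      change pure q.1.1 * w * (p * (pure q.1.2 * x)) = _
      obtain ⟨⟨a, h⟩, rfl⟩ := q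
      rw [← mul_assoc p, Ultrafilter.mul_pure_comm, ← Ultrafilter.pure_mul_pure,
        mul_assoc (pure h) p, ← mul_assoc (pure a * w), mul_assoc (pure a) w,
        Ultrafilter.mul_pure_comm h w]
      simp only [mul_assoc]⟩
  have he : Function.Injective e := fun q q' h => by
    have h' := Prod.ext_iff.1 (congrArg Subtype.val h)
    exact Subtype.ext (Prod.ext (Ultrafilter.pure_mul_injective w h'.1)
      (Ultrafilter.pure_mul_injective x (Prod.ext_iff.1 h'.2).2))
  rw [← he.tsum_eq fun q hq => ?_]
  · refine tsum_congr fun q => ?_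
    change b (pure q.1.1 * w) * (delta p p * f (pure q.1.2 * x)) = _
    rw [delta_self, one_mul, orbit_apply, orbit_apply]
  · obtain ⟨⟨z, p', c⟩, hz⟩ := q
    have hq2 := right_ne_zero_of_mul hq
    have hpp : p' = p := by
      by_contra h
      exact left_ne_zero_of_mul hq2 (delta_of_ne h)
    subst hpp
    obtain ⟨h, hc, hy⟩ := hp (pure g * w) z c (right_ne_zero_of_mul hq2) (by
      simpa only [mul_assoc] using hz.symm)
    have hz' : pure (g * h⁻¹) * w = z := by
      rw [mul_comm, ← Ultrafilter.pure_mul_pure, mul_assoc, hy, ← Ultrafilter.mul_pure_comm,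
        mul_assoc, Ultrafilter.pure_mul_pure, mul_inv_cancel, Ultrafilter.mul_pure_one]
    refine ⟨⟨(g * h⁻¹, h), inv_mul_cancel_right g h⟩, Subtype.ext ?_⟩
    simp only [e, hz', hc]

/-- A decoding point `p` shows that `f` has no coefficient at `x` if all the multiples of
`δ_p ⋆ f` are quasi-invertible. Indeed, restricting `1 + b = 1 + (1 + b) ⋆ (c δ_p ⋆ f)` to the
orbits of the powers of `p x` expresses the powers of `c F`, where `F` is the restriction of `f`
to the orbit of `x`, as restrictions of `1 + b`, so that these powers are bounded. -/
theorem apply_eq_zero_of_quasiInverse {p x : Ultrafilter G} {f : EllOne (Ultrafilter G)}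
    (hx : x ∉ Set.range (pure : G → Ultrafilter G))
    (hp : ∀ y z c : Ultrafilter G, f c ≠ 0 → y * p * x = z * p * c →
      ∃ g, c = pure g * x ∧ y = z * pure g)
    (hf : ∀ c : ℂ, ∃ b : EllOne (Ultrafilter G), (∀ g, b (pure g) = 0) ∧
      b = (c • delta p) * f + b * ((c • delta p) * f)) : f x = 0 := by
  by_contra hfx
  let F := orbit x f
  have hF1 : F 1 = f x := by
    rw [orbit_apply, Ultrafilter.pure_one_mul]
  -- With this factor, the spectral radius of `c F` is at least `2`.
  let c : ℂ := 2 * (f x)⁻¹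
  obtain ⟨b, hb0, hb⟩ := hf c
  let β : EllOne (Ultrafilter G) := delta (pure 1) + b
  have hβ : β = delta (pure 1) + c • (β * (delta p * f)) := by
    change _ + b = _ + c • ((delta (pure 1) + b) * _)
    conv_lhs => rw [hb]
    rw [add_mul, delta_mul_of_left_identity Ultrafilter.pure_one_mul, smul_add, smul_mul_assoc,
      mul_smul_comm]
  let w : ℕ → Ultrafilter G := fun n => Nat.rec (pure 1) (fun _ u => u * p * x) n
  have hw : ∀ n, orbit (w n) β = c ^ n • F ^ n := by
    intro n
    induction n with
    | zero =>
      ext g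
      rw [orbit_apply, pow_zero, pow_zero, one_smul, one_def]
      change (delta (pure 1) + b : EllOne (Ultrafilter G)) (pure g * pure 1) = _
      rw [Ultrafilter.mul_pure_one, add_apply, hb0, add_zero]
      by_cases hg : g = 1
      · rw [hg, delta_self, delta_self]
      · rw [delta_of_ne hg, delta_of_ne (Ultrafilter.pure_injective.ne hg)]
    | succ n ih =>
      have h1 := orbit_mul_delta_mul hp β (w n)
      rw [ih] at h1
      ext g
      rw [orbit_apply, hβ, add_apply, smul_apply]
      change _ + c * orbit (w n * p * x) (β * (delta p * f)) g = _
      rw [h1, delta_of_ne, zero_add, ← smul_apply, smul_mul_assoc, smul_smul, ← pow_succ',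
        ← pow_succ]
      rintro h
      exact mul_notMem_range_pure (pure g * (w n * p)) hx
        ⟨1, by rw [mul_assoc]; exact h.symm⟩
  have hbound : ∀ k : ℕ, (2 : ℝ) ^ 2 ^ k ≤ ‖β‖ := fun k => by
    have h1 := norm_comap_le (fun g => pure g * w (2 ^ k)) (Ultrafilter.pure_mul_injective _) β
    have h2 : ‖c ^ 2 ^ k • F ^ 2 ^ k‖ ≤ ‖β‖ := hw (2 ^ k) ▸ h1
    refine le_trans ?_ h2
    have h3 := norm_apply_one_pow_le F k
    rw [norm_smul, norm_pow]
    refine le_trans (le_of_eq ?_) (mul_le_mul_of_nonneg_left h3 (by positivity))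
    rw [← mul_pow, ← norm_mul, hF1]
    simp [c, hfx]
  obtain ⟨n, hn⟩ := pow_unbounded_of_one_lt ‖β‖ (one_lt_two (α := ℝ))
  exact absurd ((pow_le_pow_right₀ one_le_two Nat.lt_two_pow_self.le).trans (hbound n))
    (not_le.2 hn)

end EllOne

/-- Elements of the radical are quasi-invertible, and so are their left multiples: `1 + b` is a
left inverse of `1 - d f`. -/
theorem exists_quasiInverse_of_mem_algRadical {A : Type*} [NonUnitalRing A] [Module ℂ A]
    [IsScalarTower ℂ A A] [SMulCommClass ℂ A A] {f : A} (hf : f ∈ algRadical A) (d : A) :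
    ∃ b : A, b = d * f + b * (d * f) := by
  obtain ⟨z, hz⟩ := (mem_maximal_iff _).1 hf (-(d : Unitization ℂ A))
  have h1 := congrArg (fun w => w.toProd.1) hz
  have h2 := congrArg (fun w => w.toProd.2) hz
  simp at h1 h2
  refine ⟨z.snd, ?_⟩
  rw [h1, one_smul, add_mul, mul_assoc, neg_add_eq_zero] at h2
  exact h2.symm

/-! ### The growth of a cancellative commutative semigroup -/

theorem WithOne.exists_coe_mul {S : Type*} [Semigroup S] (a : WithOne S) (s : S) :
    ∃ s' : S, a * s = s' := by
  cases a with
  | one => exact ⟨s, one_mul _⟩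
  | coe a => exact ⟨a * s, (WithOne.coe_mul a s).symm⟩

/-- A countable cancellative commutative semigroup embeds in its group of quotients. Finitely many
elements of that group have a common denominator in the semigroup. -/
theorem exists_group_of_quotients.{u} (S : Type u) [CommSemigroup S] [IsCancelMul S] [Countable S]
    [Nonempty S] : ∃ (G : Type u) (_ : CommGroup G) (_ : Countable G) (ι : S →ₙ* G),
      Function.Injective ι ∧ ∀ F : Finset G, ∃ d : S, ∀ g ∈ F, ∃ s : S, g * ι d = ι s := by
  classical
  let ι₁ : WithOne S →* Algebra.GrothendieckGroup (WithOne S) := Algebra.GrothendieckGroup.of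
  have hcount : Countable (WithOne S) := inferInstanceAs (Countable (Option S))
  let ι : S →ₙ* Algebra.GrothendieckGroup (WithOne S) :=
    { toFun := fun s => ι₁ s
      map_mul' := fun a b => by rw [WithOne.coe_mul, map_mul] }
  refine ⟨Algebra.GrothendieckGroup (WithOne S), inferInstance, ?_, ι, fun a b hab => ?_,
    fun F => ?_⟩
  · exact Function.Surjective.countable
      (f := fun p : WithOne S × (⊤ : Submonoid (WithOne S)) => Localization.mk p.1 p.2)
      fun q => by
        induction q using Localization.ind with
        | _ p => exact ⟨p, rfl⟩
  · have h : ι₁ a = ι₁ b := hab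
    obtain ⟨⟨c, _⟩, hc⟩ := ((Localization.monoidOf (⊤ : Submonoid (WithOne S))).eq_iff_exists).1 h
    change c * (a : WithOne S) = c * b at hc
    cases c with
    | one => exact WithOne.coe_injective (by simpa using hc)
    | coe c =>
      rw [← WithOne.coe_mul, ← WithOne.coe_mul] at hc
      exact mul_left_cancel (WithOne.coe_injective hc)
  · induction F using Finset.induction_on with
    | empty => exact ⟨Classical.arbitrary S, by simp⟩
    | insert g F _ ih =>
      obtain ⟨d, hd⟩ := ih
      obtain ⟨d', s', hs'⟩ : ∃ d' s' : S, g * ι d' = ι s' := by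
        induction g using Localization.ind with
        | _ p =>
          obtain ⟨a, b, hb⟩ := p
          let s := Classical.arbitrary S
          obtain ⟨d', hd'⟩ := WithOne.exists_coe_mul b s
          obtain ⟨s', hs'⟩ := WithOne.exists_coe_mul a s
          refine ⟨d', s', ?_⟩
          change Localization.mk a ⟨b, hb⟩ * ι₁ d' = ι₁ s'
          rw [← hd', ← hs', map_mul, map_mul, ← mul_assoc]
          congr 1
          rw [Localization.mk_eq_monoidOf_mk']
          exact Submonoid.LocalizationMap.mk'_spec _ a ⟨b, hb⟩
      refine ⟨d * d', fun g' hg' => ?_⟩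
      rcases Finset.mem_insert.1 hg' with rfl | hg'
      · exact ⟨s' * d, by rw [mul_comm d, map_mul, ← mul_assoc, hs', map_mul]⟩
      · obtain ⟨s, hs⟩ := hd g' hg'
        exact ⟨s * d', by rw [map_mul, ← mul_assoc, hs, map_mul]⟩

namespace Growth

variable {S : Type*} [Semigroup S] [IsCancelMul S]

theorem val_mul (p q : Growth S) : (p * q).1 = p.1 * q.1 := rfl

/-- The homomorphism from `S*` to `βG` induced by a homomorphism from `S` to `G`. -/
def mapHom {G : Type*} [Semigroup G] (ι : S →ₙ* G) : Growth S →ₙ* Ultrafilter G where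
  toFun p := p.1.map ι
  map_mul' _ _ := by
    ext A
    simp only [Ultrafilter.mem_map, val_mul, Ultrafilter.mem_mul_iff, Set.preimage, map_mul,
      Set.mem_ofPred_eq]

theorem mapHom_apply {G : Type*} [Semigroup G] (ι : S →ₙ* G) (p : Growth S) :
    mapHom ι p = p.1.map ι := rfl

theorem mapHom_injective {G : Type*} [Semigroup G] {ι : S →ₙ* G} (hι : Function.Injective ι) :
    Function.Injective (mapHom ι) := fun _ _ h =>
  Subtype.ext (Ultrafilter.coe_injective (map_injective hι (congrArg Ultrafilter.toFilter h)))

theorem mapHom_notMem_range_pure {G : Type*} [Semigroup G] {ι : S →ₙ* G}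
    (hι : Function.Injective ι) (p : Growth S) :
    mapHom ι p ∉ Set.range (pure : G → Ultrafilter G) := by
  rintro ⟨g, hg⟩
  have h1 : ι ⁻¹' {g} ∈ p.1 := by
    rw [← Ultrafilter.mem_map, ← mapHom_apply, ← hg]
    exact Set.mem_singleton g
  obtain ⟨s, hs⟩ := p.1.nonempty_of_mem h1
  refine p.2 ⟨s, Ultrafilter.coe_injective (Ultrafilter.unique _ ?_).symm⟩
  rw [Ultrafilter.coe_pure, le_pure_iff]
  filter_upwards [h1] with t ht
  exact hι (Eq.trans ht (Eq.symm hs))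

/-- If `x` is outside some ideal of `S*`, there is `r ∈ S*` such that the closed left ideal
`βS r c` does not contain `x`, for any `c`. -/
theorem exists_avoiding_of_notMem_minIdeal {x : Growth S} (hx : x ∉ minIdeal (Growth S)) :
    ∃ r : Growth S, ∀ c : Growth S, ∃ A ∈ x.1, ∀ s : S,
      ∀ᶠ u in r.1, A ∉ pure (s * u) * c.1 := by
  obtain ⟨I, hI, hxI⟩ : ∃ I : Set (Growth S), IsSemigroupIdeal I ∧ x ∉ I := by
    simpa [minIdeal] using hx
  obtain ⟨r, hr⟩ := hI.nonempty
  refine ⟨r * r, fun c => ?_⟩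
  let L := Set.range fun y : Ultrafilter S => y * ((r * r).1 * c.1)
  have hL : IsClosed L :=
    (isCompact_range (Ultrafilter.continuous_mul_left _)).isClosed
  have hxL : x.1 ∈ Lᶜ := by
    rintro ⟨y, hy⟩
    let z : Growth S := ⟨y * r.1, mul_notMem_range_pure y r.2⟩
    refine hxI ?_
    rw [show x = z * (r * c) from Subtype.ext (by
      rw [← hy]
      change y * (r.1 * r.1 * c.1) = y * r.1 * (r.1 * c.1)
      simp only [mul_assoc])]
    exact hI.mul_mem_left _ (hI.mul_mem_right _ hr)
  obtain ⟨_, ⟨A, rfl⟩, hxA, hA⟩ :=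
    ultrafilterBasis_is_basis.exists_subset_of_mem_open hxL hL.isOpen_compl
  refine ⟨A, hxA, fun s => ?_⟩
  have h : A ∉ pure s * ((r * r).1 * c.1) := fun h =>
    hA (show pure s * ((r * r).1 * c.1) ∈ {u : Ultrafilter S | A ∈ u} from h) ⟨_, rfl⟩
  rw [← mul_assoc] at h
  have h' : {u | A ∈ pure (s * u) * c.1} ∉ (r * r).1 := h
  exact Ultrafilter.compl_mem_iff_notMem.2 h'

end Growth

theorem exists_enumeration {X : Type*} {s : Set X} (hs : s.Countable) (x : X) :
    ∃ c : ℕ → X, c 0 = x ∧ ∀ y ∈ s, ∃ k, c k = y := by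
  obtain ⟨e, he⟩ := (hs.insert x).exists_eq_range (Set.insert_nonempty x s)
  refine ⟨fun n => Nat.casesOn n x e, rfl, fun y hy => ?_⟩
  obtain ⟨k, hk⟩ : y ∈ Set.range e := he ▸ Set.mem_insert_of_mem x hy
  exact ⟨k + 1, hk⟩

/-- Elements of the radical have no coefficients outside the minimum ideal. This is stated for any
algebra with a homomorphism to `ℓ¹(S*)` whose range contains the point masses, so as to apply to
both `ℓ¹(S*)` and `ℂS*`. -/
theorem mem_minIdeal_of_mem_algRadical {S : Type*} [CommSemigroup S] [IsCancelMul S] [Countable S]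
    {R : Type*} [NonUnitalRing R] [Module ℂ R] [IsScalarTower ℂ R R] [SMulCommClass ℂ R R]
    (Θ : R →ₙₐ[ℂ] EllOne (Growth S)) (δ : Growth S → R)
    (hδ : ∀ p, Θ (δ p) = EllOne.delta p) {f : R} (hf : f ∈ algRadical R) {x : Growth S}
    (hx : Θ f x ≠ 0) : x ∈ minIdeal (Growth S) := by
  by_contra hxK
  obtain ⟨s₀, -⟩ := x.1.nonempty_of_mem univ_mem
  have : Nonempty S := ⟨s₀⟩
  obtain ⟨G, _, _, ι, hι, hden⟩ := exists_group_of_quotients S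
  have hJ := Growth.mapHom_injective hι
  obtain ⟨c, hc0, hc⟩ := exists_enumeration (Θ f).summable_norm.of_norm.countable_support x
  obtain ⟨r, hr⟩ := Growth.exists_avoiding_of_notMem_minIdeal hxK
  choose A hAx hA using fun k => hr (c k)
  obtain ⟨p, hpι, hp, hdec⟩ := Ultrafilter.exists_decoding_point (x := Growth.mapHom ι x)
    (C := fun k => Growth.mapHom ι (c k)) (A := fun k => ι '' A k) (T := Set.range ι)
    (by rw [hc0]) (fun k => Ultrafilter.mem_map.2 (mem_of_superset (hAx k)
      (Set.subset_preimage_image _ _))) (fun F N => by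
    obtain ⟨d, hd⟩ := hden F
    choose! s hs using hd
    -- Every `u` in a set of `r` works, after multiplication by the common denominator `d` of `F`.
    have hev : ∀ᶠ u in r.1, ∀ k ∈ Finset.Iic N, ∀ g ∈ F, A k ∉ pure (s g * u) * (c k).1 := by
      simp only [eventually_all_finset]
      exact fun k _ g _ => hA k (s g)
    obtain ⟨u, hu⟩ := hev.exists
    refine ⟨ι (d * u), ⟨_, rfl⟩, fun k hk g hg h => hu k (Finset.mem_Iic.2 hk) g hg ?_⟩
    rw [map_mul, ← mul_assoc, hs g hg, ← map_mul, Ultrafilter.mem_pure_mul_iff,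
      Growth.mapHom_apply, Ultrafilter.mem_map] at h
    rw [Ultrafilter.mem_pure_mul_iff]
    filter_upwards [h] with b hb
    obtain ⟨a, ha, hab⟩ := hb
    rw [← map_mul] at hab
    exact hι hab ▸ ha)
  -- The decoding point contains the image of `S`, so it comes from a point of `S*`.
  obtain ⟨p', hp'⟩ : ∃ p' : Growth S, Growth.mapHom ι p' = p := by
    have hmap : (p.comap hι hpι).map ι = p :=
      Ultrafilter.coe_injective (map_comap_of_mem hpι)
    refine ⟨⟨p.comap hι hpι, ?_⟩, hmap⟩
    rintro ⟨s, hs⟩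
    exact hp ⟨ι s, by rw [← hmap, ← hs, Ultrafilter.map_pure]⟩
  let Ψ := (EllOne.map (Growth.mapHom ι) hJ).comp Θ
  have hΨδ : Ψ (δ p') = EllOne.delta p := by
    rw [NonUnitalAlgHom.comp_apply, hδ, EllOne.map_delta, hp']
  refine hx ?_
  rw [← EllOne.map_apply (Growth.mapHom ι) hJ]
  refine EllOne.apply_eq_zero_of_quasiInverse (p := p) (f := Ψ f)
    (Growth.mapHom_notMem_range_pure hι x) (fun y z d hd hyz => ?_) (fun a => ?_)
  · by_cases hdr : d ∈ Set.range (Growth.mapHom ι)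
    · obtain ⟨d, rfl⟩ := hdr
      obtain ⟨k, rfl⟩ := hc d (by
        rwa [NonUnitalAlgHom.comp_apply, EllOne.map_apply] at hd)
      exact hdec y z k hyz
    · exact absurd (EllOne.map_apply_of_notMem _ hJ _ hdr) hd
  · obtain ⟨b, hb⟩ := exists_quasiInverse_of_mem_algRadical hf (a • δ p')
    refine ⟨Ψ b, fun g => EllOne.map_apply_of_notMem _ hJ _ ?_, ?_⟩
    · rintro ⟨q, hq⟩
      exact Growth.mapHom_notMem_range_pure hι q ⟨g, hq.symm⟩
    · conv_lhs => rw [hb]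
      rw [map_add, map_mul Ψ b, map_mul, map_smul, hΨδ]

end

theorem mainTheorem2 (S : Type*) [CommSemigroup S] [IsCancelMul S] [Countable S] :
    (∀ f : EllOne (Growth S), f ∈ algRadical (EllOne (Growth S)) →
      {x | f x ≠ 0} ⊆ minIdeal (Growth S)) ∧
    (∀ f : MonoidAlgebra ℂ (Growth S), f ∈ algRadical (MonoidAlgebra ℂ (Growth S)) →
      {x | f.coeff x ≠ 0} ⊆ minIdeal (Growth S)) := by
  refine ⟨fun f hf x hx => ?_, fun f hf x hx => ?_⟩
  · exact mem_minIdeal_of_mem_algRadical (R := EllOne (Growth S))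
      (NonUnitalAlgHom.id ℂ (EllOne (Growth S))) EllOne.delta (fun _ => rfl) hf hx
  · refine mem_minIdeal_of_mem_algRadical (EllOne.ofMonoidAlgebra (Growth S))
      (fun p => MonoidAlgebra.single p 1) (fun p => ?_) hf ?_
    · rw [EllOne.ofMonoidAlgebra_single, one_smul]
    · rw [EllOne.ofMonoidAlgebra_apply]
      exact hx
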